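/- A set $S$ of positive integers is called $s$-Bohr ($s\ge 1$) if it is a recurrence set for every product of $s$ circle rotations: for all $\lambda_1,\dots,\lambda_s\in\mathbb T=\{z\in\mathbb C: |z|=1\}$ and every $\varepsilon>0$ there is $n\in S$ with $\max_{1\le i\le s}|\lambda_i^n-1|<\varepsilon$. Let $r\ge 1$. There exist positive integers $\Delta_{N,A}(\ell)$, $\Theta_N(\ell)$, $Q_N(\ell)$ for all $N\ge 1$, $\ell\ge 1$ and $A\subseteq\{1,\dots,r-1\}$, with the following property. For sequences $(L_N)_{N\ge1}$ and $(H_N)_{N\ge1}$ of positive integers write $\Delta_{N,A}=\Delta_{N,A}(L_N)$, $\Theta_N=\Theta_N(L_N)$, $Q_N=Q_N(L_N)$ (so these parameters depend on $N$ and $L_N$, but not on $(H_N)$), and put $$S_{L,H}=\bigcup_{N\ge1}B_{N,0}\ \cup\bigcup_{A\subseteq\{1,\dots,r-1\}}\ \bigcup_{N\ge1}B_{N,A},$$ where $$B_{N,0}=\{H_Nq+1: 1\le q\le Q_N\},\qquad B_{N,\varnothing}=\{H_N\Delta_{N,\varnothing}\},$$ $$B_{N,A}=\{H_N\Delta_{N,A}(L_Nj+1):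 1\le j\le\Theta_N\}\quad(A\ne\varnothing).$$ Then: 1. for all sequences $(L_N)$ and $(H_N)$ of positive integers, $S_{L,H}$ is $r$-Bohr; 2. if $(L_N)$ and $(H_N)$ grow sufficiently fast, with $L_N\ll H_N\ll L_{N+1}$, then $S_{L,H}$ is not $(2^{r-1}+1)$-Bohr. Precisely: there is a function $F:\mathbb N\to\mathbb N$ such that $S_{L,H}$ is not $(2^{r-1}+1)$-Bohr whenever $0\ll L_1$ and $L_N\ll H_N\ll L_{N+1}$ for all $N\ge1$, where $x\ll y$ means that $y>x$ and $y\ge F(x)$. In particular, for each $r\ge1$ there exist sets of integers of this form which are $r$-Bohr but not $(2^{r-1}+1)$-Bohr. -/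

import Mathlib

/-- `S` is a recurrence set for the dynamical system `(X, d, f)`: for every `ε > 0` there are
`n ∈ S` and `x ∈ X` with `d (fⁿ x, x) < ε`. -/
def IsRecurrenceSetFor {X : Type*} [MetricSpace X] (S : Set ℕ) (f : X → X) : Prop :=
  ∀ ε : ℝ, 0 < ε → ∃ n ∈ S, ∃ x : X, dist (f^[n] x) x < ε

/-- The product rotation `(z₁, …, z_r) ↦ (lam₁ z₁, …, lam_r z_r)` of the torus `𝕋 ^ r`. -/
noncomputable def prodRotation {r : ℕ} (lam : Fin r → Circle) (z : Fin r → Circle) : Fin r → Circle :=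
  fun i => lam i * z i

/-- `S` is `r`-Bohr: it is a recurrence set for every product of `r` circle rotations. -/
def IsRBohr (r : ℕ) (S : Set ℕ) : Prop :=
  ∀ lam : Fin r → Circle, IsRecurrenceSetFor S (prodRotation lam)

/-- The block `{H q + 1 ; 1 ≤ q ≤ Q}`. -/
def blockZero (H Q : ℕ) : Set ℕ :=
  {n | ∃ q : ℕ, 1 ≤ q ∧ q ≤ Q ∧ n = H * q + 1}

/-- The block `B_A`: for `A = ∅` it is the singleton `{H D}`, and for `A ≠ ∅` it is
`{H D (L j + 1) ; 1 ≤ j ≤ T}`. -/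
def blockSub (A : Finset ℕ) (H D L T : ℕ) : Set ℕ :=
  {n | (A = ∅ ∧ n = H * D) ∨
    (A ≠ ∅ ∧ ∃ j : ℕ, 1 ≤ j ∧ j ≤ T ∧ n = H * D * (L * j + 1))}

/-- The union over `N ≥ 1` of the blocks `B_{N,0}` and `B_{N,A}`, `A ⊆ {1, …, r - 1}`, with
parameters `L N`, `H N`, `D N A`, `T N`, `Q N` (sequences indexed by `N ≥ 1`). -/
def blockUnion (r : ℕ) (L H : ℕ → ℕ) (D : ℕ → Finset ℕ → ℕ) (T Q : ℕ → ℕ) : Set ℕ :=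
  (⋃ N ∈ Set.Ici 1, blockZero (H N) (Q N)) ∪
    ⋃ A ∈ {A : Finset ℕ | A ⊆ Finset.Icc 1 (r - 1)},
      ⋃ N ∈ Set.Ici 1, blockSub A (H N) (D N A) (L N) (T N)

/-- `x ≪ y`, measured by the growth function `F`. -/
def MuchLess (F : ℕ → ℕ) (x y : ℕ) : Prop :=
  x < y ∧ F x ≤ y

/-- The sequences `(L_N)` and `(H_N)`, `N ≥ 1`, grow at least as fast as `F` prescribes:
`0 ≪ L₁ ≪ H₁ ≪ L₂ ≪ H₂ ≪ …`. -/
def GrowsFast (F : ℕ → ℕ) (L H : ℕ → ℕ) : Prop :=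
  MuchLess F 0 (L 1) ∧
    ∀ N : ℕ, 1 ≤ N → MuchLess F (L N) (H N) ∧ MuchLess F (H N) (L (N + 1))

/-! Recurrence rests on a Kronecker dichotomy (`Circle.exists_pow_near_or_relation`): either some `u
^ q * y` with `1 ≤ q ≤ Q` is close to `1`, or the coordinates of `u` almost satisfy a relation with
coefficients bounded by `K`. With `u = x ^ H`, `y = x`, the first case is a hit in `blockZero`. In
the second, `Circle.exists_reduction` moves the problem for `x ^ H` to a torus of one dimension
less, and the dichotomy is repeated with `u = t ^ L`, `y = t`, hitting some `L * q + 1`, until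
dimension zero. All constants are uniform in the point, hence independent of `H`. Block `N` achieves
precision `1 / N`.

For non-recurrence, each of the `2 ^ (r - 1) + 1` families of blocks is defeated by a single
rotation. For `M * (L * j + 1)`, take `M * x` near `⌊L / 2⌋ / L` modulo one: multiplication by `L *
j` then contributes almost nothing. For `H * q + 1`, take `H * x` near `0` and `x` near `1 / 2`.
Fast growth lets one `x` serve all `N`, by nested intervals. -/

/-! ### Distance to the identity on the circle. -/

theorem Circle.dist_eq_norm (z w : Circle) : dist z w = ‖(z : ℂ) - w‖ :=
  _root_.dist_eq_norm (z : ℂ) w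

theorem Circle.dist_mul_one_le (z w : Circle) : dist (z * w) 1 ≤ dist z 1 + dist w 1 := by
  have h : dist (z * w) z = dist w 1 := by
    simp only [Circle.dist_eq_norm, Circle.coe_mul, Circle.coe_one]
    rw [show (z : ℂ) * w - z = z * (w - 1) by ring, norm_mul, Circle.norm_coe, one_mul]
  linarith [dist_triangle (z * w) z 1]

theorem Circle.dist_inv_one (z : Circle) : dist z⁻¹ 1 = dist z 1 := by
  simp only [Circle.dist_eq_norm, Circle.coe_inv, Circle.coe_one]
  rw [show ((z : ℂ)⁻¹ - 1) = (z : ℂ)⁻¹ * (1 - z) by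
    rw [mul_sub, inv_mul_cancel₀ z.coe_ne_zero, mul_one], norm_mul, norm_inv, Circle.norm_coe,
    inv_one, one_mul, norm_sub_rev]

theorem Circle.dist_pow_one_le (z : Circle) (n : ℕ) : dist (z ^ n) 1 ≤ n * dist z 1 := by
  induction n with
  | zero => simp
  | succ n ih =>
    rw [pow_succ]
    push_cast
    linarith [Circle.dist_mul_one_le (z ^ n) z]

theorem Circle.dist_zpow_one_le (z : Circle) (k : ℤ) :
    dist (z ^ k) 1 ≤ k.natAbs * dist z 1 := by
  rcases Int.natAbs_eq k with h | h
  · rw [h, zpow_natCast, Int.natAbs_natCast]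
    exact Circle.dist_pow_one_le z _
  · rw [h, zpow_neg, Circle.dist_inv_one, zpow_natCast, Int.natAbs_neg, Int.natAbs_natCast]
    exact Circle.dist_pow_one_le z _

theorem Circle.dist_prod_one_le {ι : Type*} (s : Finset ι) (z : ι → Circle) :
    dist (∏ i ∈ s, z i) 1 ≤ ∑ i ∈ s, dist (z i) 1 := by
  classical
  induction s using Finset.induction_on with
  | empty => simp
  | insert a s ha ih =>
    rw [Finset.prod_insert ha, Finset.sum_insert ha]
    linarith [Circle.dist_mul_one_le (z a) (∏ i ∈ s, z i)]

/-! ### A nonnegative trigonometric kernel and geometric sums. -/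

/-- The value at `w` of the trigonometric kernel `((2 + w + w⁻¹) / 4) ^ n`. -/
noncomputable def Circle.kernel (n : ℕ) (w : Circle) : ℝ := (1 - dist w 1 ^ 2 / 4) ^ n

theorem Circle.dist_one_le_two (w : Circle) : dist w 1 ≤ 2 := by
  rw [Circle.dist_eq_norm]
  refine (norm_sub_le _ _).trans ?_
  rw [Circle.norm_coe, Circle.norm_coe]
  norm_num

theorem Circle.kernel_nonneg (n : ℕ) (w : Circle) : 0 ≤ Circle.kernel n w := by
  have := w.dist_one_le_two
  have h0 : 0 ≤ dist w 1 := dist_nonneg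
  exact pow_nonneg (by nlinarith) n

theorem Circle.kernel_le_one (n : ℕ) (w : Circle) : Circle.kernel n w ≤ 1 := by
  have := w.dist_one_le_two
  have h0 : 0 ≤ dist w 1 := dist_nonneg
  exact pow_le_one₀ (by nlinarith) (by nlinarith)

theorem Circle.kernel_le (n : ℕ) (w : Circle) {ε : ℝ} (hε : 0 ≤ ε) (h : ε ≤ dist w 1) :
    Circle.kernel n w ≤ (1 - ε ^ 2 / 4) ^ n := by
  have := w.dist_one_le_two
  have h0 : 0 ≤ dist w 1 := dist_nonneg
  exact pow_le_pow_left₀ (by nlinarith) (by nlinarith) n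

/-- The base of the power equals `(w + 1) ^ 2 / (4 * w)`, so the binomial theorem gives the Fourier
coefficients; they are nonnegative and have frequencies at most `n` in absolute value. -/
theorem Circle.coe_kernel_eq_sum (n : ℕ) (w : Circle) :
    (Circle.kernel n w : ℂ) = ∑ j ∈ Finset.range (2 * n + 1),
      (((2 * n).choose j / 4 ^ n : ℝ) : ℂ) * ((w ^ ((j : ℤ) - n) : Circle) : ℂ) := by
  have hw : (w : ℂ) ≠ 0 := w.coe_ne_zero
  have h1 : ((1 - dist w 1 ^ 2 / 4 : ℝ) : ℂ) = (w + 1) ^ 2 / (4 * w) := by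
    have h2 : ((dist w 1 ^ 2 : ℝ) : ℂ) = (w - 1) * ((w : ℂ)⁻¹ - 1) := by
      rw [Circle.dist_eq_norm, ← Complex.normSq_eq_norm_sq, ← Complex.mul_conj]
      simp only [Circle.coe_one, map_sub, map_one, ← Circle.coe_inv_eq_conj, Circle.coe_inv]
    push_cast at h2 ⊢
    rw [h2]
    field_simp
    ring
  rw [Circle.kernel, Complex.ofReal_pow, h1, div_pow, ← pow_mul, add_pow, Finset.sum_div]
  refine Finset.sum_congr rfl fun j _ => ?_
  rw [Circle.coe_zpow, zpow_sub₀ hw]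
  push_cast
  simp only [zpow_natCast, one_pow, mul_one, mul_pow]
  field_simp

theorem Circle.norm_sum_pow_le (w : Circle) {δ : ℝ} (hδ : 0 < δ) (h : δ ≤ dist w 1) (Q : ℕ) :
    ‖∑ q ∈ Finset.range Q, (w : ℂ) ^ (q + 1)‖ ≤ 2 / δ := by
  rw [Circle.dist_eq_norm] at h
  have hne : (w : ℂ) ≠ 1 := by
    rintro h'
    rw [h'] at h
    simp at h
    linarith
  simp only [pow_succ]
  rw [← Finset.sum_mul, norm_mul, Circle.norm_coe, mul_one, geom_sum_eq hne, norm_div]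
  refine div_le_div₀ (by norm_num) ?_ hδ h
  refine (norm_sub_le _ _).trans ?_
  rw [norm_pow, Circle.norm_coe]
  norm_num

theorem Circle.prod_kernel_eq_sum {ι : Type*} [Fintype ι] [DecidableEq ι] (n : ℕ) (w : ι → Circle) :
    ((∏ i, Circle.kernel n (w i) : ℝ) : ℂ) =
      ∑ j ∈ Fintype.piFinset fun _ : ι => Finset.range (2 * n + 1),
        ((∏ i, ((2 * n).choose (j i) / 4 ^ n : ℝ) : ℝ) : ℂ) *
          ((∏ i, w i ^ ((j i : ℤ) - n) : Circle) : ℂ) := by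
  push_cast
  simp only [Circle.coe_kernel_eq_sum]
  rw [Finset.prod_univ_sum]
  refine Finset.sum_congr rfl fun j _ => ?_
  rw [Finset.prod_mul_distrib]
  congr 1
  · push_cast; rfl
  · exact (map_prod Circle.coeHom (fun i => w i ^ ((j i : ℤ) - n)) Finset.univ).symm

theorem Circle.sum_prod_kernel_coeff {ι : Type*} [Fintype ι] [DecidableEq ι] (n : ℕ) :
    ∑ j ∈ Fintype.piFinset fun _ : ι => Finset.range (2 * n + 1),
      ∏ i, ((2 * n).choose (j i) / 4 ^ n : ℝ) = 1 := by
  rw [← Finset.prod_univ_sum (fun _ : ι => Finset.range (2 * n + 1))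
    (fun _ a => ((2 * n).choose a / 4 ^ n : ℝ))]
  refine Finset.prod_eq_one fun i _ => ?_
  rw [← Finset.sum_div, ← Nat.cast_sum, Nat.sum_range_choose, pow_mul]
  norm_num

/-- Away from `1` the kernel decays exponentially in `n`, whereas its mean over the torus decays
only polynomially; this makes the mean win. -/
theorem exists_pow_lt_inv_pow (m : ℕ) {ρ : ℝ} (h0 : 0 ≤ ρ) (h1 : ρ < 1) :
    ∃ n : ℕ, ρ ^ n < (1 / (2 * n + 1 : ℝ)) ^ m := by
  have h := (tendsto_pow_const_mul_const_pow_of_abs_lt_one m (r := ρ)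
    (by rwa [abs_of_nonneg h0])).const_mul ((3 : ℝ) ^ m)
  rw [mul_zero] at h
  obtain ⟨n, hn, hn1⟩ := ((h.eventually_lt_const one_pos).and (Filter.eventually_ge_atTop 1)).exists
  refine ⟨n, ?_⟩
  have hn' : (1 : ℝ) ≤ n := by exact_mod_cast hn1
  rw [div_pow, one_pow, lt_div_iff₀ (by positivity)]
  calc ρ ^ n * (2 * n + 1 : ℝ) ^ m ≤ ρ ^ n * (3 * n : ℝ) ^ m := by gcongr; linarith
    _ = 3 ^ m * (n ^ m * ρ ^ n) := by rw [mul_pow]; ring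
    _ < 1 := hn

/-! ### Quantitative Kronecker theorem. -/

/-- A quantitative Kronecker theorem: an orbit of length `Q` of a rotation of a torus comes close
to any given point, unless the rotation almost satisfies a relation with small coefficients. -/
theorem Circle.exists_pow_near_or_relation (ι : Type*) [Fintype ι] {ε : ℝ} (hε : 0 < ε)
    (hε1 : ε ≤ 1) : ∃ K : ℕ, ∀ δ : ℝ, 0 < δ → ∃ Q : ℕ, 1 ≤ Q ∧ ∀ u y : ι → Circle,
      (∃ q, 1 ≤ q ∧ q ≤ Q ∧ ∀ i, dist (u i ^ q * y i) 1 < ε) ∨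
      ∃ k : ι → ℤ, k ≠ 0 ∧ (∀ i, (k i).natAbs ≤ K) ∧ dist (∏ i, u i ^ k i) 1 < δ := by
  classical
  -- The degree `n`, which becomes `K`, depends only on `ε` and the dimension. It is fixed before
  -- `δ`, and the later induction needs this order.
  obtain ⟨n, hn⟩ := exists_pow_lt_inv_pow (Fintype.card ι) (ρ := 1 - ε ^ 2 / 4) (by nlinarith)
    (by nlinarith)
  refine ⟨n, fun δ hδ => ?_⟩
  set c : (ι → ℕ) → ℝ := fun j => ∏ i, ((2 * n).choose (j i) / 4 ^ n : ℝ) with hc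
  set J := Fintype.piFinset fun _ : ι => Finset.range (2 * n + 1) with hJ
  set j0 : ι → ℕ := fun _ => n with hj0
  set ρ := (1 - ε ^ 2 / 4) ^ n with hρ
  have hcnn : ∀ j, 0 ≤ c j := fun j => Finset.prod_nonneg fun i _ => by positivity
  have hj0J : j0 ∈ J := by simp [hJ, hj0]; omega
  have hc0 : ρ < c j0 := by
    refine hn.trans_le ?_
    simp only [hc, hj0, Finset.prod_const, Finset.card_univ]
    refine pow_le_pow_left₀ (by positivity) ?_ _
    rw [div_le_div_iff₀ (by positivity) (by positivity), one_mul]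
    have := Nat.four_pow_le_two_mul_add_one_mul_central_binom n
    rw [mul_comm]
    exact_mod_cast this
  -- If both alternatives fail, the kernel sum is at most `Q * ρ`, but at least `Q * c j0 - 2 / δ`;
  -- this `Q` makes the two incompatible.
  obtain ⟨Q, hQ⟩ := exists_nat_gt (2 / δ / (c j0 - ρ))
  have hQ0 : 0 < (Q : ℝ) := lt_of_le_of_lt (by have := sub_pos.2 hc0; positivity) hQ
  refine ⟨Q, by exact_mod_cast hQ0, fun u y => ?_⟩
  by_contra! hcon
  obtain ⟨hfar, hrel⟩ := hcon
  have hk : ∀ j ∈ J, j ≠ j0 → δ ≤ dist (∏ i, u i ^ ((j i : ℤ) - n)) 1 := by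
    intro j hj hne
    refine hrel (fun i => (j i : ℤ) - n) ?_ fun i => ?_
    · intro h0
      refine hne (funext fun i => ?_)
      have := congrFun h0 i
      simp only [Pi.zero_apply] at this
      simp only [hj0]
      omega
    · have := Fintype.mem_piFinset.1 hj i
      rw [Finset.mem_range] at this
      omega
  have hle : ∑ q ∈ Finset.range Q, ∏ i, Circle.kernel n (u i ^ (q + 1) * y i) ≤ Q * ρ := by
    refine (Finset.sum_le_card_nsmul _ _ ρ fun q hq => ?_).trans (by simp)
    rw [Finset.mem_range] at hq
    obtain ⟨i, hi⟩ := hfar (q + 1) (by omega) (by omega)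
    rw [← Finset.mul_prod_erase Finset.univ _ (Finset.mem_univ i)]
    calc _ ≤ ρ * 1 := by
          gcongr
          · exact Finset.prod_nonneg fun _ _ => Circle.kernel_nonneg _ _
          · exact pow_nonneg (by nlinarith) n
          · exact Circle.kernel_le n _ hε.le hi
          · exact Finset.prod_le_one (fun _ _ => Circle.kernel_nonneg _ _)
              fun _ _ => Circle.kernel_le_one _ _
      _ = ρ := mul_one ρ
  set χ : (ι → Circle) → (ι → ℕ) → Circle := fun z j => ∏ i, z i ^ ((j i : ℤ) - n) with hχ
  -- The frequency-zero term `j0` yields the mean; every other character sums to a geometric series,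
  -- bounded because there is no small relation.
  have hexp : ((∑ q ∈ Finset.range Q, ∏ i, Circle.kernel n (u i ^ (q + 1) * y i) : ℝ) : ℂ) =
      ∑ j ∈ J, ((c j : ℂ) * (χ y j : ℂ)) * ∑ q ∈ Finset.range Q, (χ u j : ℂ) ^ (q + 1) := by
    rw [Complex.ofReal_sum]
    simp only [Circle.prod_kernel_eq_sum, Finset.mul_sum]
    rw [Finset.sum_comm]
    refine Finset.sum_congr rfl fun j _ => Finset.sum_congr rfl fun q _ => ?_
    rw [mul_assoc, ← Circle.coe_pow, ← Circle.coe_mul]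
    congr 3
    simp only [hχ]
    rw [← Finset.prod_pow, ← Finset.prod_mul_distrib]
    refine Finset.prod_congr rfl fun i _ => ?_
    rw [mul_zpow, mul_comm, ← zpow_natCast, ← zpow_natCast, ← zpow_mul, ← zpow_mul,
      mul_comm (_ - _)]
  rw [← Finset.add_sum_erase _ _ hj0J] at hexp
  have hz : ∀ z, χ z j0 = 1 := fun z => by simp [hχ, hj0]
  rw [hz, hz] at hexp
  simp only [Circle.coe_one, one_pow, mul_one, Finset.sum_const, Finset.card_range,
    nsmul_eq_mul] at hexp
  have hrest : ‖∑ j ∈ J.erase j0, ((c j : ℂ) * (χ y j : ℂ)) *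
      ∑ q ∈ Finset.range Q, (χ u j : ℂ) ^ (q + 1)‖ ≤ 2 / δ := by
    refine (norm_sum_le _ _).trans ?_
    calc _ ≤ ∑ j ∈ J.erase j0, c j * (2 / δ) := by
          refine Finset.sum_le_sum fun j hj => ?_
          rw [Finset.mem_erase] at hj
          rw [norm_mul, norm_mul, Circle.norm_coe, mul_one, Complex.norm_of_nonneg (hcnn j)]
          exact mul_le_mul_of_nonneg_left (Circle.norm_sum_pow_le _ hδ (hk j hj.2 hj.1) Q) (hcnn j)
      _ ≤ ∑ j ∈ J, c j * (2 / δ) :=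
          Finset.sum_le_sum_of_subset_of_nonneg (Finset.erase_subset _ _)
            fun j _ _ => mul_nonneg (hcnn j) (by positivity)
      _ = 2 / δ := by rw [← Finset.sum_mul, Circle.sum_prod_kernel_coeff, one_mul]
  have hre := (Complex.abs_re_le_norm _).trans hrest
  rw [← sub_eq_iff_eq_add'] at hexp
  rw [← hexp, ← Complex.ofReal_natCast, ← Complex.ofReal_mul, ← Complex.ofReal_sub,
    Complex.ofReal_re] at hre
  have := neg_le_of_abs_le hre
  rw [div_lt_iff₀ (sub_pos.2 hc0)] at hQ
  nlinarith

/-! ### Lowering the dimension and building the blocks. -/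

/-- A point `u` of the torus of dimension `m + 1` that almost satisfies a relation with coefficients
bounded by `K` is controlled, up to the factor `K !`, by a point of a torus of dimension `m`. -/
theorem Circle.exists_reduction {m K : ℕ} {ε δ : ℝ} (hε : 0 < ε) {k : Fin (m + 1) → ℤ}
    (hk0 : k ≠ 0) (hk : ∀ i, (k i).natAbs ≤ K) {u : Fin (m + 1) → Circle}
    (hu : dist (∏ i, u i ^ k i) 1 < δ) :
    ∃ s : Fin m → Circle, ∀ n : ℕ, (∀ b, dist (s b ^ n) 1 < ε / (2 * (m + 1) * (K + 1))) →
      K.factorial * n * δ ≤ ε / 2 → ∀ i, dist (u i ^ (K.factorial * n)) 1 < ε := by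
  obtain ⟨a, ha⟩ := Function.ne_iff.1 hk0
  simp only [Pi.zero_apply] at ha
  -- With `K! = k a * M`, the exponent `K! * n` does not depend on the relation. Coordinate `a` is
  -- recovered from the relation raised to `M * n`, the others from `s b ^ n` raised to `k a`.
  obtain ⟨M, hM⟩ : k a ∣ (K.factorial : ℤ) :=
    Int.natAbs_dvd.1 (Int.natCast_dvd_natCast.2 (Nat.dvd_factorial (Int.natAbs_pos.2 ha) (hk a)))
  have hMle : M.natAbs ≤ K.factorial := by
    have h := congrArg Int.natAbs hM
    rw [Int.natAbs_natCast, Int.natAbs_mul] at h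
    rw [h]
    exact Nat.le_mul_of_pos_left _ (Int.natAbs_pos.2 ha)
  refine ⟨fun b => u (a.succAbove b) ^ M, fun n hs hn i => ?_⟩
  set ε' := ε / (2 * (m + 1) * (K + 1)) with hε'
  have hε'0 : 0 < ε' := by positivity
  have hε'eq : (m + 1) * (K + 1) * ε' = ε / 2 := by rw [hε']; field_simp
  have hm : (0 : ℝ) ≤ m := Nat.cast_nonneg m
  have hK : (0 : ℝ) ≤ K := Nat.cast_nonneg K
  have hpow : ∀ c : ℤ, c.natAbs ≤ K → ∀ b,
      dist (((u (a.succAbove b) ^ M) ^ n) ^ c) 1 ≤ K * ε' := by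
    intro c hc b
    refine (Circle.dist_zpow_one_le _ _).trans ?_
    have := (hs b).le
    gcongr
  rcases Fin.eq_self_or_eq_succAbove a i with rfl | ⟨b, rfl⟩
  · have hrel := Fin.prod_univ_succAbove (fun j => u j ^ k j) i
    set E := ∏ j, u j ^ k j
    clear_value E
    have hexp : u i ^ (K.factorial * n) = (E ^ M) ^ n *
        ∏ b, ((u (i.succAbove b) ^ M) ^ n) ^ (-k (i.succAbove b)) := by
      have h1 : u i ^ k i = E * ∏ b, u (i.succAbove b) ^ (-k (i.succAbove b)) := by
        simp only [zpow_neg, Finset.prod_inv_distrib]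
        exact eq_mul_inv_of_mul_eq hrel.symm
      rw [pow_mul, ← zpow_natCast (u i), hM, zpow_mul, h1, mul_zpow, mul_pow, ← Finset.prod_zpow,
        ← Finset.prod_pow]
      refine congrArg ((E ^ M) ^ n * ·) (Finset.prod_congr rfl fun b _ => ?_)
      simp only [← zpow_natCast, ← zpow_mul]
      congr 1
      ring
    rw [hexp]
    have hE : dist ((E ^ M) ^ n) 1 ≤ ε / 2 := by
      refine (Circle.dist_pow_one_le _ _).trans (le_trans ?_ hn)
      have h1 := Circle.dist_zpow_one_le E M
      have h2 : (M.natAbs : ℝ) * dist E 1 ≤ K.factorial * δ := by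
        gcongr
      calc (n : ℝ) * dist (E ^ M) 1 ≤ n * (K.factorial * δ) := by
            gcongr
            exact h1.trans h2
        _ = _ := by ring
    have hP := (Circle.dist_prod_one_le Finset.univ
      fun b => ((u (i.succAbove b) ^ M) ^ n) ^ (-k (i.succAbove b))).trans
        (Finset.sum_le_card_nsmul _ _ _ fun b _ => hpow _ (by rw [Int.natAbs_neg]; exact hk _) b)
    rw [Finset.card_univ, Fintype.card_fin, nsmul_eq_mul] at hP
    have hmK : m * (K * ε') < (m + 1) * (K + 1) * ε' := by nlinarith [mul_nonneg hm hK]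
    linarith [Circle.dist_mul_one_le ((E ^ M) ^ n)
      (∏ b, ((u (i.succAbove b) ^ M) ^ n) ^ (-k (i.succAbove b)))]
  · have hexp : u (a.succAbove b) ^ (K.factorial * n) =
        ((u (a.succAbove b) ^ M) ^ n) ^ k a := by
      simp only [← zpow_natCast, ← zpow_mul]
      congr 1
      push_cast
      rw [hM]
      ring
    rw [hexp]
    have := hpow (k a) (hk a) b
    nlinarith [mul_nonneg hm hK, mul_nonneg hm hε'0.le, mul_nonneg (mul_nonneg hm hK) hε'0.le]

/-- The multipliers `D i * (L * j + 1)`, with `i ≤ m` and `1 ≤ j ≤ T` (but `j = 0` for `i = 0`),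
bring every point of the set `P` of `m'`-tuples within `ε` of the identity. -/
def IsScheme {m' : ℕ} (L m : ℕ) (ε : ℝ) (P : Set (Fin m' → Circle)) (D : ℕ → ℕ) (T : ℕ) : Prop :=
  (∀ i, 1 ≤ D i) ∧ 1 ≤ T ∧ ∀ u ∈ P, ∃ i ≤ m, ∃ j ≤ T, (j = 0 ↔ i = 0) ∧
    ∀ a, dist (u a ^ (D i * (L * j + 1))) 1 < ε

/-- The tolerance `δ` is chosen after the lower-dimensional scheme, small enough that the error in
the relation stays harmless under the largest multiplier, which is at most `K! * B`. -/
theorem IsScheme.exists_of_relation {L m K : ℕ} {ε : ℝ} (hε : 0 < ε)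
    (h : ∃ D T, IsScheme L m (ε / (2 * (m + 1) * (K + 1))) (Set.univ : Set (Fin m → Circle)) D T) :
    ∃ δ : ℝ, 0 < δ ∧ ∃ D T, IsScheme L m ε {u : Fin (m + 1) → Circle |
      ∃ k : Fin (m + 1) → ℤ, k ≠ 0 ∧ (∀ i, (k i).natAbs ≤ K) ∧
        dist (∏ i, u i ^ k i) 1 < δ} D T := by
  obtain ⟨D, T, hD, hT, h⟩ := h
  set B := (∑ i ∈ Finset.range (m + 1), D i) * (L * T + 1) with hB
  have hB0 : 0 < B := by
    refine Nat.mul_pos ?_ (Nat.succ_pos _)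
    exact (hD 0).trans (Finset.single_le_sum (f := D) (fun _ _ => Nat.zero_le _) (by simp))
  refine ⟨ε / (2 * (K.factorial * B)), by positivity, fun i => K.factorial * D i, T,
    fun i => Nat.mul_pos K.factorial_pos (hD i), hT, ?_⟩
  rintro u ⟨k, hk0, hk, hu⟩
  obtain ⟨s, hs⟩ := Circle.exists_reduction hε hk0 hk hu
  obtain ⟨i, hi, j, hj, hij, hsc⟩ := h s (Set.mem_univ s)
  refine ⟨i, hi, j, hj, hij, ?_⟩
  rw [mul_assoc]
  refine hs _ hsc ?_
  have hle : D i * (L * j + 1) ≤ B := by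
    refine Nat.mul_le_mul ?_ (by gcongr)
    exact Finset.single_le_sum (f := D) (fun _ _ => Nat.zero_le _)
      (Finset.mem_range.2 (Nat.lt_succ_of_le hi))
  have hle' : ((D i * (L * j + 1) : ℕ) : ℝ) ≤ B := by exact_mod_cast hle
  calc _ ≤ (K.factorial : ℝ) * B * (ε / (2 * (K.factorial * B))) := by gcongr
    _ = ε / 2 := by field_simp

theorem exists_isScheme {L : ℕ} (hL : 1 ≤ L) (m : ℕ) : ∀ ε : ℝ, 0 < ε → ε ≤ 1 →
    ∃ D T, IsScheme L m ε (Set.univ : Set (Fin m → Circle)) D T := by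
  induction m with
  | zero =>
    exact fun ε hε _ => ⟨fun _ => 1, 1, fun _ => le_rfl, le_rfl,
      fun u _ => ⟨0, le_rfl, 0, Nat.zero_le _, Iff.rfl, fun a => a.elim0⟩⟩
  | succ m ih =>
    intro ε hε hε1
    obtain ⟨K, hK⟩ := Circle.exists_pow_near_or_relation (Fin (m + 1)) hε hε1
    have hden : (1 : ℝ) ≤ 2 * (m + 1) * (K + 1) := by
      have : (0 : ℝ) ≤ m * K := by positivity
      nlinarith [Nat.cast_nonneg (α := ℝ) m, Nat.cast_nonneg (α := ℝ) K]
    obtain ⟨δ, hδ, D, T, hD, hT, h⟩ := IsScheme.exists_of_relation (L := L) (m := m) (K := K) hε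
      (ih _ (by positivity) ((div_le_self hε.le hden).trans hε1))
    obtain ⟨Q, hQ1, hQ⟩ := hK δ hδ
    -- A direct hit of `t ^ (L * q + 1)` is the new top level, with multiplier `1`. Otherwise the
    -- relation concerns `t ^ L`, so the old multipliers acquire a factor `L`.
    refine ⟨fun i => if i ≤ m then L * D i else 1, max T Q, fun i => ?_, le_max_of_le_left hT,
      fun t _ => ?_⟩
    · dsimp only
      split_ifs
      exacts [Nat.mul_pos hL (hD i), le_rfl]
    · rcases hQ (fun i => t i ^ L) t with ⟨q, hq1, hq, hnear⟩ | hrel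
      · refine ⟨m + 1, le_rfl, q, le_max_of_le_right hq, by omega, fun a => ?_⟩
        dsimp only
        rw [if_neg (by omega), one_mul, pow_succ, pow_mul]
        exact hnear a
      · obtain ⟨i, hi, j, hj, hij, hu⟩ := h _ hrel
        refine ⟨i, by omega, j, le_max_of_le_left hj, hij, fun a => ?_⟩
        dsimp only
        rw [if_pos hi, mul_assoc, pow_mul]
        exact hu a

/-- Block parameters that bring every point of the torus of dimension `r` within `ε` of the
identity, whatever `H` is. -/
theorem exists_blocks {r : ℕ} (hr : 1 ≤ r) {L : ℕ} (hL : 1 ≤ L) {ε : ℝ} (hε : 0 < ε)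
    (hε1 : ε ≤ 1) : ∃ (D : Finset ℕ → ℕ) (T Q : ℕ), (∀ A, 1 ≤ D A) ∧ 1 ≤ T ∧ 1 ≤ Q ∧
      ∀ (H : ℕ) (x : Fin r → Circle), ∃ n, (n ∈ blockZero H Q ∨
        ∃ A ⊆ Finset.Icc 1 (r - 1), n ∈ blockSub A H (D A) L T) ∧ ∀ i, dist (x i ^ n) 1 < ε := by
  obtain ⟨m, rfl⟩ := Nat.exists_eq_add_of_le' hr
  obtain ⟨K, hK⟩ := Circle.exists_pow_near_or_relation (Fin (m + 1)) hε hε1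
  have hden : (1 : ℝ) ≤ 2 * (m + 1) * (K + 1) := by
    have : (0 : ℝ) ≤ m * K := by positivity
    nlinarith [Nat.cast_nonneg (α := ℝ) m, Nat.cast_nonneg (α := ℝ) K]
  obtain ⟨δ, hδ, D, T, hD, hT, h⟩ := IsScheme.exists_of_relation (L := L) (m := m) (K := K) hε
    (exists_isScheme hL m _ (by positivity) ((div_le_self hε.le hden).trans hε1))
  obtain ⟨Q, hQ1, hQ⟩ := hK δ hδ
  -- Only the cardinality of `A` matters, and the sets `Finset.Icc 1 i` suffice: one block for each
  -- dimension reached. Level `0` forces `j = 0`, which is the singleton block of `∅`.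
  refine ⟨fun A => D A.card, T, Q, fun A => hD _, hT, hQ1, fun H x => ?_⟩
  rcases hQ (fun i => x i ^ H) x with ⟨q, hq1, hq, hnear⟩ | hrel
  · refine ⟨H * q + 1, Or.inl ⟨q, hq1, hq, rfl⟩, fun i => ?_⟩
    rw [pow_succ, pow_mul]
    exact hnear i
  · obtain ⟨i, hi, j, hj, hij, hu⟩ := h _ hrel
    refine ⟨H * D i * (L * j + 1), Or.inr ⟨Finset.Icc 1 i, Finset.Icc_subset_Icc le_rfl hi, ?_⟩,
      fun a => ?_⟩
    · dsimp only
      rw [Nat.card_Icc, Nat.add_sub_cancel]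
      rcases Nat.eq_zero_or_pos i with rfl | hi0
      · exact Or.inl ⟨by simp, by rw [hij.2 rfl]; simp⟩
      · exact Or.inr ⟨by simpa using hi0.ne', j,
          Nat.pos_of_ne_zero fun h0 => hi0.ne' (hij.1 h0), hj, rfl⟩
    · rw [mul_assoc, pow_mul]
      exact hu a

/-! ### Reals with prescribed multiples modulo one. -/

/-- Nested intervals: if the integers `M n` grow fast enough, then some real `x` has all the
multiples `M n * x` close to prescribed targets modulo one. -/
theorem exists_real_forall_mul_near (M : ℕ → ℕ) (c δ : ℕ → ℝ) (hM : ∀ n, 1 ≤ M n)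
    (hδ0 : ∀ n, 0 < δ n) (hδ : ∀ n, δ n ≤ 1 / 2) (h : ∀ n, (M n : ℝ) ≤ M (n + 1) * δ n) :
    ∃ x : ℝ, ∀ n, ∃ k : ℤ, |M n * x - c n - k| ≤ δ n := by
  have hM0 : ∀ n, (0 : ℝ) < M n := fun n => by exact_mod_cast hM n
  let k : (n : ℕ) → ℝ → ℤ := fun n t => round (M n * t - c n)
  let X : ℕ → ℝ := fun n => Nat.rec (c 0 / M 0)
    (fun n t => (c (n + 1) + k (n + 1) t) / M (n + 1)) n
  have hXk : ∀ n, ∃ k : ℤ, M n * X n = c n + k := by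
    rintro (_ | n)
    · exact ⟨0, by
        change M 0 * (c 0 / M 0) = _
        rw [mul_div_cancel₀ _ (hM0 0).ne', Int.cast_zero, add_zero]⟩
    · exact ⟨k (n + 1) (X n), by
        change M (n + 1) * ((c (n + 1) + k (n + 1) (X n)) / M (n + 1)) = _
        rw [mul_div_cancel₀ _ (hM0 _).ne']⟩
  -- Exact solutions at stage `n + 1` are spaced `1 / M (n + 1)` apart, so the nearest one and its
  -- interval fit inside the interval of stage `n`.
  have hstep : ∀ n, |X (n + 1) - X n| + δ (n + 1) / M (n + 1) ≤ δ n / M n := by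
    intro n
    have h1 : X (n + 1) - X n =
        -((M (n + 1) * X n - c (n + 1)) - k (n + 1) (X n)) / M (n + 1) := by
      change (c (n + 1) + k (n + 1) (X n)) / M (n + 1) - X n = _
      field_simp [(hM0 (n + 1)).ne']
      ring
    have h2 : |X (n + 1) - X n| ≤ 1 / 2 / M (n + 1) := by
      rw [h1, abs_div, abs_neg, abs_of_pos (hM0 (n + 1))]
      gcongr
      exact abs_sub_round _
    have h3 : δ (n + 1) / M (n + 1) ≤ 1 / 2 / M (n + 1) := by
      gcongr
      exact hδ _
    have h4 : 1 / (M (n + 1) : ℝ) ≤ δ n / M n := by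
      rw [div_le_div_iff₀ (hM0 _) (hM0 _)]
      linarith [h n]
    have h5 : 1 / (M (n + 1) : ℝ) = 1 / 2 / M (n + 1) + 1 / 2 / M (n + 1) := by ring
    linarith
  have hmono : Monotone fun n => X n - δ n / M n := monotone_nat_of_le_succ fun n => by
    linarith [hstep n, neg_abs_le (X (n + 1) - X n)]
  have hanti : Antitone fun n => X n + δ n / M n := antitone_nat_of_succ_le fun n => by
    linarith [hstep n, le_abs_self (X (n + 1) - X n)]
  have hpos : ∀ n, 0 < δ n / M n := fun n => div_pos (hδ0 n) (hM0 n)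
  have hx := hmono.ciSup_mem_iInter_Icc_of_antitone hanti fun n => by linarith [hpos n]
  refine ⟨⨆ n, (X n - δ n / M n), fun n => ?_⟩
  obtain ⟨h1, h2⟩ := Set.mem_iInter.1 hx n
  obtain ⟨k, hk⟩ := hXk n
  refine ⟨k, ?_⟩
  generalize (⨆ n, X n - δ n / M n) = x at h1 h2
  rw [show M n * x - c n - k = M n * (x - X n) by rw [mul_sub, hk]; ring, abs_mul,
    abs_of_pos (hM0 n), ← le_div_iff₀' (hM0 n), abs_le]
  constructor <;> linarith

/-- A point of the circle close to `1` has its argument close to an integer multiple of `2π`. -/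
theorem Circle.exists_int_of_dist_exp_lt {y : ℝ}
    (h : dist (Circle.exp (2 * Real.pi * y)) 1 < 1 / 2) : ∃ k : ℤ, |y - k| < 1 / 8 := by
  refine ⟨round y, ?_⟩
  have hper : Circle.exp (2 * Real.pi * y) = Circle.exp (2 * Real.pi * (y - round y)) := by
    rw [mul_sub, Circle.exp_sub, mul_comm (2 * Real.pi) (round y : ℝ),
      Circle.exp_int_mul_two_pi, div_one]
  have hf := abs_sub_round y
  rw [hper] at h
  set f := y - round y
  rw [Circle.dist_eq_norm, Circle.coe_exp, Circle.coe_one, mul_comm,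
    Complex.norm_exp_I_mul_ofReal_sub_one,
    show 2 * Real.pi * f / 2 = Real.pi * f by ring, norm_mul, Real.norm_eq_abs, Real.norm_eq_abs,
    abs_two] at h
  have hpi := Real.pi_pos
  -- Jordan's inequality gives `4 * |f| ≤ 2 * |sin (π * f)| < 1 / 2`.
  have := Real.mul_abs_le_abs_sin (x := Real.pi * f) (by rw [abs_mul, abs_of_pos hpi]; nlinarith)
  rw [abs_mul, abs_of_pos hpi, ← mul_assoc, div_mul_cancel₀ _ hpi.ne'] at this
  linarith

/-! ### Recurrence of rotations in terms of powers. -/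

theorem iterate_prodRotation {r : ℕ} (lam : Fin r → Circle) (n : ℕ) (z : Fin r → Circle) :
    (prodRotation lam)^[n] z = fun i => lam i ^ n * z i := by
  induction n with
  | zero => simp
  | succ n ih =>
    rw [Function.iterate_succ_apply', ih]
    funext i
    simp only [prodRotation, pow_succ', mul_assoc]

theorem Circle.dist_mul_self_eq (z w : Circle) : dist (z * w) w = dist z 1 := by
  rw [Circle.dist_eq_norm, Circle.dist_eq_norm, Circle.coe_mul, Circle.coe_one,
    show (z : ℂ) * w - w = (z - 1) * w by ring, norm_mul, Circle.norm_coe, mul_one]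

theorem isRBohr_of_forall_exists {r : ℕ} {S : Set ℕ}
    (h : ∀ x : Fin r → Circle, ∀ ε : ℝ, 0 < ε → ∃ n ∈ S, ∀ i, dist (x i ^ n) 1 < ε) :
    IsRBohr r S := by
  intro lam ε hε
  obtain ⟨n, hn, hlam⟩ := h lam ε hε
  refine ⟨n, hn, 1, ?_⟩
  rw [iterate_prodRotation, dist_pi_lt_iff hε]
  intro i
  rw [Pi.one_apply, mul_one]
  exact hlam i

theorem not_isRBohr_of_forall_far {r : ℕ} {S : Set ℕ} (x : Fin r → ℝ)
    (h : ∀ n ∈ S, ∃ i, ∀ k : ℤ, 1 / 8 ≤ |n * x i - k|) : ¬ IsRBohr r S := by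
  intro hS
  obtain ⟨n, hn, z, hz⟩ := hS (fun i => Circle.exp (2 * Real.pi * x i)) (1 / 2) (by norm_num)
  rw [iterate_prodRotation, dist_pi_lt_iff (by norm_num)] at hz
  obtain ⟨i, hi⟩ := h n hn
  have hzi := hz i
  rw [Circle.dist_mul_self_eq, ← Circle.exp_natCast_mul,
    show (n : ℝ) * (2 * Real.pi * x i) = 2 * Real.pi * (n * x i) by ring] at hzi
  obtain ⟨k, hk⟩ := Circle.exists_int_of_dist_exp_lt hzi
  exact absurd (hi k) (not_le.2 hk)

/-! ### One rotation against each family of blocks. -/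

theorem exists_real_far_progression (M L T : ℕ → ℕ) (hM : ∀ N, 1 ≤ N → 1 ≤ M N)
    (hL : ∀ N, 1 ≤ N → 2 ≤ L N) (hM1 : 2 ≤ M 1)
    (hgrow : ∀ N, 1 ≤ N → M N * (8 * (L N * T N + 1)) ≤ M (N + 1)) :
    ∃ x : ℝ, ∀ N, 1 ≤ N → ∀ j ≤ T N, ∀ k : ℤ, 1 / 8 ≤ |((M N * (L N * j + 1) : ℕ) : ℝ) * x - k| := by
  obtain ⟨x, hx⟩ := exists_real_forall_mul_near (fun n => if n = 0 then 1 else M n)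
    (fun n => ((L n / 2 : ℕ) : ℝ) / L n)
    (fun n => if n = 0 then 1 / 2 else 1 / (8 * (L n * T n + 1))) (fun n => by
      split_ifs with h
      exacts [le_rfl, hM n (Nat.pos_of_ne_zero h)]) (fun n => by
      split_ifs with h <;> positivity) (fun n => by
      split_ifs with h
      · exact le_rfl
      · rw [div_le_div_iff₀ (by positivity) (by norm_num)]
        nlinarith [(by positivity : (0 : ℝ) ≤ L n * T n)]) (fun n => by
      rw [if_neg n.succ_ne_zero]
      split_ifs with h
      · subst h
        have : (2 : ℝ) ≤ M 1 := by exact_mod_cast hM1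
        push_cast
        linarith
      · have : ((M n * (8 * (L n * T n + 1)) : ℕ) : ℝ) ≤ M (n + 1) := by
          exact_mod_cast hgrow n (Nat.pos_of_ne_zero h)
        push_cast at this
        rw [mul_one_div, le_div_iff₀ (by positivity)]
        exact this)
  refine ⟨x, fun N hN j hj k => ?_⟩
  obtain ⟨k0, hk0⟩ := hx N
  simp only [if_neg (by omega : N ≠ 0)] at hk0
  have hL2 := hL N hN
  have hL0 : (0 : ℝ) < L N := by exact_mod_cast (by omega : 0 < L N)
  set c : ℝ := ((L N / 2 : ℕ) : ℝ) / L N with hc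
  have hc1 : 1 / 3 ≤ c := by
    rw [hc, div_le_div_iff₀ (by norm_num) hL0]
    exact_mod_cast (by omega : 1 * L N ≤ (L N / 2) * 3)
  have hc2 : c ≤ 1 / 2 := by
    rw [hc, div_le_div_iff₀ hL0 (by norm_num)]
    exact_mod_cast (by omega : (L N / 2) * 2 ≤ 1 * L N)
  have hLc : (L N : ℝ) * c = ((L N / 2 : ℕ) : ℝ) := mul_div_cancel₀ _ hL0.ne'
  set e := (L N * j + 1) * (M N * x - c - k0) with he
  have he8 : |e| ≤ 1 / 8 := by
    have hjT : (j : ℝ) ≤ T N := by exact_mod_cast hj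
    rw [he, abs_mul, abs_of_pos (by positivity)]
    calc _ ≤ (L N * T N + 1 : ℝ) * (1 / (8 * (L N * T N + 1))) := by gcongr
      _ = 1 / 8 := by field_simp
  -- As `L N * c` is an integer, only `c` and the error survive modulo one; `1 / 3 ≤ c ≤ 1 / 2` and
  -- `|e| ≤ 1 / 8` keep the sum away from the integers.
  obtain ⟨z, hz⟩ : ∃ z : ℤ, ((M N * (L N * j + 1) : ℕ) : ℝ) * x - k = e + c + z := by
    obtain ⟨h, hh⟩ : ∃ h : ℤ, (L N : ℝ) * c = h := ⟨(L N / 2 : ℕ), by rw [hLc, Int.cast_natCast]⟩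
    refine ⟨h * j + (L N * j + 1) * k0 - k, ?_⟩
    rw [he]
    push_cast
    rw [← hh]
    ring
  rw [hz]
  by_contra! hlt
  rw [abs_lt] at hlt
  rw [abs_le] at he8
  rcases le_or_gt 0 z with h | h
  · have : (0 : ℝ) ≤ z := by exact_mod_cast h
    linarith [hlt.2, he8.1]
  · have : (z : ℝ) ≤ -1 := by exact_mod_cast (by omega : z ≤ -1)
    linarith [hlt.1, he8.2]

theorem exists_real_far_translate (H Q : ℕ → ℕ) (hH : ∀ N, 1 ≤ N → 1 ≤ H N) (hH1 : 4 ≤ H 1)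
    (hgrow : ∀ N, 1 ≤ N → H N * (8 * (Q N + 1)) ≤ H (N + 1)) :
    ∃ x : ℝ, ∀ N, 1 ≤ N → ∀ q ≤ Q N, ∀ k : ℤ, 1 / 8 ≤ |((H N * q + 1 : ℕ) : ℝ) * x - k| := by
  -- The spare index `0`, with multiplier `1`, carries the condition that `x` be within `1 / 4` of
  -- `1 / 2` modulo one. Adding the error `1 / 8` still leaves distance `1 / 8` to the integers.
  obtain ⟨x, hx⟩ := exists_real_forall_mul_near (fun n => if n = 0 then 1 else H n)
    (fun n => if n = 0 then 1 / 2 else 0)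
    (fun n => if n = 0 then 1 / 4 else 1 / (8 * (Q n + 1))) (fun n => by
      split_ifs with h
      exacts [le_rfl, hH n (Nat.pos_of_ne_zero h)]) (fun n => by
      split_ifs with h <;> positivity) (fun n => by
      split_ifs with h
      · norm_num
      · rw [div_le_div_iff₀ (by positivity) (by norm_num)]
        nlinarith [(Nat.cast_nonneg (Q n) : (0 : ℝ) ≤ Q n)]) (fun n => by
      rw [if_neg n.succ_ne_zero]
      split_ifs with h
      · subst h
        have : (4 : ℝ) ≤ H 1 := by exact_mod_cast hH1
        push_cast
        linarith
      · have : ((H n * (8 * (Q n + 1)) : ℕ) : ℝ) ≤ H (n + 1) := by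
          exact_mod_cast hgrow n (Nat.pos_of_ne_zero h)
        push_cast at this
        rw [mul_one_div, le_div_iff₀ (by positivity)]
        exact this)
  refine ⟨x, fun N hN q hq k => ?_⟩
  obtain ⟨k1, hk1⟩ := hx 0
  obtain ⟨k0, hk0⟩ := hx N
  simp only [if_neg (by omega : N ≠ 0), sub_zero] at hk0
  simp only [if_true, Nat.cast_one, one_mul] at hk1
  set e := q * (H N * x - k0) with he
  have he8 : |e| ≤ 1 / 8 := by
    have hqQ : (q : ℝ) ≤ Q N + 1 := by exact_mod_cast hq.trans (Nat.le_succ _)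
    rw [he, abs_mul, Nat.abs_cast]
    calc _ ≤ (Q N + 1 : ℝ) * (1 / (8 * (Q N + 1))) := by gcongr
      _ = 1 / 8 := by field_simp
  obtain ⟨z, hz⟩ : ∃ z : ℤ, ((H N * q + 1 : ℕ) : ℝ) * x - k = e + (x - 1 / 2 - k1) + 1 / 2 + z := by
    refine ⟨q * k0 + k1 - k, ?_⟩
    rw [he]
    push_cast
    ring
  rw [hz]
  by_contra! hlt
  rw [abs_lt] at hlt
  rw [abs_le] at he8 hk1
  rcases le_or_gt 0 z with h | h
  · have : (0 : ℝ) ≤ z := by exact_mod_cast h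
    linarith [hlt.2, he8.1, hk1.1]
  · have : (z : ℝ) ≤ -1 := by exact_mod_cast (by omega : z ≤ -1)
    linarith [hlt.1, he8.2, hk1.2]

theorem exists_growth_not_isRBohr (r : ℕ) (D : ℕ → ℕ → Finset ℕ → ℕ) (T Q : ℕ → ℕ → ℕ)
    (hD : ∀ N l, 1 ≤ N → 1 ≤ l → ∀ A : Finset ℕ, A ⊆ Finset.Icc 1 (r - 1) → 1 ≤ D N l A) :
    ∃ F : ℕ → ℕ, ∀ L H : ℕ → ℕ, GrowsFast F L H →
      ¬ IsRBohr (2 ^ (r - 1) + 1) (blockUnion r L H (fun N => D N (L N)) (fun N => T N (L N))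
        (fun N => Q N (L N))) := by
  set P := (Finset.Icc 1 (r - 1)).powerset with hP
  let G : ℕ → ℕ → ℕ → ℕ := fun h N l => h * (8 * (Q N l + 1)) +
    ∑ A ∈ P, h * D N l A * (8 * (l * T N l + 1))
  -- `F` sees only the value `h = H N`, so it sums over all pairs of `N` and `l` up to `h`; the true
  -- index and `L N` are among them because `N < L N < H N`.
  refine ⟨fun h => 4 + ∑ N ∈ Finset.range (h + 1), ∑ l ∈ Finset.range (h + 1), G h N l,
    fun L H hF => ?_⟩
  obtain ⟨⟨-, hL1⟩, hLH⟩ := hF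
  have hL4 : 4 ≤ L 1 := (Nat.le_add_right _ _).trans hL1
  have hNL : ∀ N, 1 ≤ N → N + 3 ≤ L N := by
    intro N hN
    induction N, hN using Nat.le_induction with
    | base => exact hL4
    | succ N hN ih =>
      have h1 := (hLH N hN).1.1
      have h2 := (hLH N hN).2.1
      omega
  have hLltH : ∀ N, 1 ≤ N → L N < H N := fun N hN => (hLH N hN).1.1
  have hG : ∀ N, 1 ≤ N → G (H N) N (L N) ≤ H (N + 1) := by
    intro N hN
    have h1 := hNL N hN
    have h2 := hLltH N hN
    have h3 := (hLH N hN).2.2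
    have h4 := hLltH (N + 1) (by omega)
    refine le_trans ?_ (h3.trans h4.le)
    refine le_trans ?_ (Nat.le_add_left _ _)
    refine le_trans ?_ (Finset.single_le_sum
      (f := fun N' => ∑ l ∈ Finset.range (H N + 1), G (H N) N' l)
      (fun _ _ => Nat.zero_le _) (Finset.mem_range.2 (by omega : N < H N + 1)))
    exact Finset.single_le_sum (f := fun l => G (H N) N l) (fun _ _ => Nat.zero_le _)
      (Finset.mem_range.2 (by omega : L N < H N + 1))
  have hDpos : ∀ A ∈ P, ∀ N, 1 ≤ N → 1 ≤ D N (L N) A := fun A hA N hN =>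
    hD N (L N) hN (by have := hNL N hN; omega) A (Finset.mem_powerset.1 hA)
  obtain ⟨x0, hx0⟩ := exists_real_far_translate H (fun N => Q N (L N))
    (fun N hN => by have := hLltH N hN; omega) (by have := hLltH 1 le_rfl; omega)
    (fun N hN => (Nat.le_add_right _ _).trans (hG N hN))
  have hA : ∀ A ∈ P, ∃ x : ℝ, ∀ N, 1 ≤ N → ∀ j ≤ T N (L N), ∀ k : ℤ,
      1 / 8 ≤ |((H N * D N (L N) A * (L N * j + 1) : ℕ) : ℝ) * x - k| := by
    intro A hA
    refine exists_real_far_progression (fun N => H N * D N (L N) A) L (fun N => T N (L N))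
      (fun N hN => ?_) (fun N hN => ?_) ?_ fun N hN => ?_
    · exact Nat.mul_pos (by have := hLltH N hN; omega) (hDpos A hA N hN)
    · have := hNL N hN
      omega
    · exact le_trans (by have := hLltH 1 le_rfl; omega)
        (Nat.le_mul_of_pos_right (H 1) (hDpos A hA 1 le_rfl))
    · refine le_trans ?_ (Nat.le_mul_of_pos_right (H (N + 1)) (hDpos A hA (N + 1) (by omega)))
      refine le_trans ?_ (hG N hN)
      refine le_trans ?_ (Nat.le_add_left _ _)
      exact Finset.single_le_sum
        (f := fun A => H N * D N (L N) A * (8 * (L N * T N (L N) + 1)))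
        (fun _ _ => Nat.zero_le _) hA
  choose! x hx using hA
  have hcard : Fintype.card (Option P) = 2 ^ (r - 1) + 1 := by
    rw [Fintype.card_option, Fintype.card_coe, hP, Finset.card_powerset, Nat.card_Icc,
      Nat.add_sub_cancel]
  let e : Option P ≃ Fin (2 ^ (r - 1) + 1) := Fintype.equivFinOfCardEq hcard
  let y : Option P → ℝ := fun o => o.elim x0 fun A => x A
  refine not_isRBohr_of_forall_far (fun i => y (e.symm i)) fun n hn => ?_
  suffices h : ∃ o, ∀ k : ℤ, 1 / 8 ≤ |n * y o - k| by
    obtain ⟨o, ho⟩ := h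
    exact ⟨e o, by simpa only [Equiv.symm_apply_apply] using ho⟩
  simp only [blockUnion, Set.mem_union, Set.mem_iUnion, Set.mem_Ici, Set.mem_ofPred_eq,
    exists_prop] at hn
  rcases hn with ⟨N, hN, q, -, hq, rfl⟩ | ⟨A, hA, N, hN, hn⟩
  · exact ⟨none, hx0 N hN q hq⟩
  · have hAP : A ∈ P := Finset.mem_powerset.2 hA
    refine ⟨some ⟨A, hAP⟩, ?_⟩
    rcases hn with ⟨-, rfl⟩ | ⟨-, j, -, hj, rfl⟩
    · have h0 := hx A hAP N hN 0 (Nat.zero_le _)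
      rw [mul_zero, zero_add, mul_one] at h0
      exact h0
    · exact hx A hAP N hN j hj

/-! ### Assembly of both halves. -/

theorem theorem2 (r : ℕ) (hr : 1 ≤ r) :
    ∃ (Δ : ℕ → ℕ → Finset ℕ → ℕ) (Θ Q : ℕ → ℕ → ℕ),
      -- `Δ N l A`, `Θ N l`, `Q N l` are positive integers, used with `l = L N`
      (∀ N l : ℕ, 1 ≤ N → 1 ≤ l → 1 ≤ Θ N l ∧ 1 ≤ Q N l ∧
        ∀ A : Finset ℕ, A ⊆ Finset.Icc 1 (r - 1) → 1 ≤ Δ N l A) ∧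
      -- whatever the sequences `L` and `H` are, the set is `r`-Bohr
      (∀ L H : ℕ → ℕ, (∀ N : ℕ, 1 ≤ N → 1 ≤ L N ∧ 1 ≤ H N) →
        IsRBohr r (blockUnion r L H (fun N => Δ N (L N)) (fun N => Θ N (L N))
          (fun N => Q N (L N)))) ∧
      -- if `L` and `H` grow sufficiently fast, the set is not `(2 ^ (r - 1) + 1)`-Bohr
      (∃ F : ℕ → ℕ, ∀ L H : ℕ → ℕ, GrowsFast F L H →
        ¬ IsRBohr (2 ^ (r - 1) + 1) (blockUnion r L H (fun N => Δ N (L N))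
          (fun N => Θ N (L N)) (fun N => Q N (L N)))) := by
  have hblocks : ∀ N l : ℕ, ∃ (D : Finset ℕ → ℕ) (T Q : ℕ), 1 ≤ N → 1 ≤ l →
      (∀ A, 1 ≤ D A) ∧ 1 ≤ T ∧ 1 ≤ Q ∧ ∀ (H : ℕ) (x : Fin r → Circle), ∃ n,
        (n ∈ blockZero H Q ∨ ∃ A ⊆ Finset.Icc 1 (r - 1), n ∈ blockSub A H (D A) l T) ∧
          ∀ i, dist (x i ^ n) 1 < 1 / (N : ℝ) := by
    intro N l
    by_cases h : 1 ≤ N ∧ 1 ≤ l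
    · have hN : (1 : ℝ) ≤ N := by exact_mod_cast h.1
      obtain ⟨D, T, Q, hb⟩ := exists_blocks hr h.2 (ε := 1 / (N : ℝ)) (by positivity)
        (by rwa [div_le_one (by positivity)])
      exact ⟨D, T, Q, fun _ _ => hb⟩
    · exact ⟨fun _ => 1, 1, 1, fun h1 h2 => absurd ⟨h1, h2⟩ h⟩
  choose D T Q hb using hblocks
  refine ⟨D, T, Q, fun N l hN hl => ⟨(hb N l hN hl).2.1, (hb N l hN hl).2.2.1,
    fun A _ => (hb N l hN hl).1 A⟩, fun L H hLH => isRBohr_of_forall_exists fun x ε hε => ?_,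
    exists_growth_not_isRBohr r D T Q fun N l hN hl A _ => (hb N l hN hl).1 A⟩
  obtain ⟨N, hN⟩ := exists_nat_one_div_lt hε
  obtain ⟨n, hn, hx⟩ := (hb (N + 1) (L (N + 1)) N.succ_pos (hLH _ N.succ_pos).1).2.2.2
    (H (N + 1)) x
  refine ⟨n, ?_, fun i => (hx i).trans (by exact_mod_cast hN)⟩
  simp only [blockUnion, Set.mem_union, Set.mem_iUnion, Set.mem_Ici, Set.mem_ofPred_eq,
    exists_prop]
  rcases hn with hn | ⟨A, hA, hn⟩
  · exact Or.inl ⟨N + 1, N.succ_pos, hn⟩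
  · exact Or.inr ⟨A, hA, N + 1, N.succ_pos, hn⟩
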